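/- Two classes $\mathcal C$, $\mathcal D$ of topological spaces are called equivalent if every member of $\mathcal C$ is homeomorphic to a member of $\mathcal D$ and vice versa. A compact (respectively Polish) composition of a class $\mathcal C$ of topological spaces is a continuous map $q\colon A\to B$ between metrizable compact spaces (respectively Polish spaces), possibly empty, such that the family of fibers $\{q^{-1}(b) : b\in B\}$, with their subspace topologies and with empty fibers included, is equivalent to $\mathcal C$. The composition is called strong if $q$ is both a closed map and an open map and $|B\setminus q[A]|\le 1$. A class $\mathcal C$ is called compactifiable (respectively Polishable, strongly compactifiable, strongly Polishable) if there is a compact (respectively Polish, strong compact, strong Polish) composition of $\mathcal C$. Proposition. Let $I$ be a countable (possibly finite or empty) set and let $\mathcal C_i$, $i\in I$, be classes of topological spaces. 1. If every $\mathcal C_i$ is strongly compactifiable, then $\bigcup_{i\in I}\mathcal C_i$ is strongly compactifiable. 2. If every $\mathcal C_i$ is compactifiable, then $\bigcup_{i\in I}\mathcal C_i$ is compactifiable. 3. If every $\mathcal C_i$ is strongly Polishable, then $\bigcup_{i\in I}\mathcal C_i$ is strongly Polishable. 4. If every $\mathcal C_i$ is Polishable, then $\bigcup_{i\in I}\mathcal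 C_i$ is Polishable. -/

import Mathlib

open TopologicalSpace

universe u v

/-- Two classes of topological spaces are equivalent if every member of either class is
homeomorphic to some member of the other one. -/
def ClassEquiv (C : Set TopCat.{u}) (D : Set TopCat.{v}) : Prop :=
  (∀ X ∈ C, ∃ Y ∈ D, Nonempty (X ≃ₜ Y)) ∧ (∀ Y ∈ D, ∃ X ∈ C, Nonempty (X ≃ₜ Y))

/-- A composition: a continuous map `q : A → B` between topological spaces. -/
structure TopComposition : Type (u + 1) where
  /-- the composition space -/
  A : TopCat.{u}
  /-- the indexing space -/
  B : TopCat.{u}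
  /-- the composition map -/
  q : C(A, B)

namespace TopComposition

/-- The class of all fibers `q ⁻¹ {b}`, `b ∈ B`, with their subspace topologies
(the empty fibers are included). -/
def fibers (𝒜 : TopComposition.{u}) : Set TopCat.{u} :=
  Set.range fun b : 𝒜.B => TopCat.of (𝒜.q ⁻¹' {b} : Set 𝒜.A)

/-- `𝒜` is a composition of the class `C`. -/
def IsCompositionOf (𝒜 : TopComposition.{u}) (C : Set TopCat.{u}) : Prop :=
  ClassEquiv 𝒜.fibers C

/-- Both spaces are metrizable compacta. -/
def IsCompactMetrizable (𝒜 : TopComposition.{u}) : Prop :=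
  (CompactSpace 𝒜.A ∧ MetrizableSpace 𝒜.A) ∧ (CompactSpace 𝒜.B ∧ MetrizableSpace 𝒜.B)

/-- Both spaces are Polish. -/
def IsPolish (𝒜 : TopComposition.{u}) : Prop :=
  PolishSpace 𝒜.A ∧ PolishSpace 𝒜.B

/-- The composition map is closed and open, and at most one point of the indexing space
lies outside its range. -/
def IsStrong (𝒜 : TopComposition.{u}) : Prop :=
  IsClosedMap 𝒜.q ∧ IsOpenMap 𝒜.q ∧ ((Set.range 𝒜.q)ᶜ : Set 𝒜.B).Subsingleton

end TopComposition

/-- The class `C` has a compact composition. -/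
def Compactifiable (C : Set TopCat.{u}) : Prop :=
  ∃ 𝒜 : TopComposition.{u}, 𝒜.IsCompactMetrizable ∧ 𝒜.IsCompositionOf C

/-- The class `C` has a Polish composition. -/
def Polishable (C : Set TopCat.{u}) : Prop :=
  ∃ 𝒜 : TopComposition.{u}, 𝒜.IsPolish ∧ 𝒜.IsCompositionOf C

/-- The class `C` has a strong compact composition. -/
def StronglyCompactifiable (C : Set TopCat.{u}) : Prop :=
  ∃ 𝒜 : TopComposition.{u}, 𝒜.IsStrong ∧ 𝒜.IsCompactMetrizable ∧ 𝒜.IsCompositionOf C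

/-- The class `C` has a strong Polish composition. -/
def StronglyPolishable (C : Set TopCat.{u}) : Prop :=
  ∃ 𝒜 : TopComposition.{u}, 𝒜.IsStrong ∧ 𝒜.IsPolish ∧ 𝒜.IsCompositionOf C

open Topology Set Filter
open scoped OnePoint

/-! Disjoint sums settle the Polish statements; in the strong case empty fibers are first discarded
and then restored by one isolated point of the indexing space. An infinite sum of compacta need not
be compact, so the indexing space becomes the one-point compactification of the sum of the `B j`,
and over infinity sits a fiber `F` that already occurs, so that no new type of fiber appears. Inside
`OnePoint (Σ j, A j) × ℓ^∞`, `F` is embedded over infinity and each `A j` is the graph of a map into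
`ℓ^∞` (`exists_attached`). Compactness only needs these maps to bring `A j` close to `F`; constant
maps suffice for plain compactifiability.

Openness needs in addition that the image of every fiber come close to all of `F`. Continuous images
of a compactum `K` approximate `F` if `K` splits into arbitrarily many clopen pieces, or if `K` has
at least as many one-point components and at least as many infinite ones as `F`, all numbers being
finite. Since `ℕ × ℕ` is well-quasi-ordered (Dickson), finitely many limit fibers serve all fibers
(`exists_finite_approximatedBy`). An approximation persists over a neighborhood
(`ApproximatedBy.exists_nhds`), so each `B j` is covered by finitely many closed pieces, each
assigned to a limit fiber. The pieces assigned to the same limit fiber are attached to it, and the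
finitely many results are summed. -/

/-! ### Equivalence of classes and their nonempty members. -/

theorem ClassEquiv.trans {C D E : Set TopCat.{u}} (h : ClassEquiv C D) (h' : ClassEquiv D E) :
    ClassEquiv C E := by
  constructor
  · intro X hX
    obtain ⟨Y, hY, ⟨e⟩⟩ := h.1 X hX
    obtain ⟨Z, hZ, ⟨e'⟩⟩ := h'.1 Y hY
    exact ⟨Z, hZ, ⟨e.trans e'⟩⟩
  · intro Z hZ
    obtain ⟨Y, hY, ⟨e⟩⟩ := h'.2 Z hZ
    obtain ⟨X, hX, ⟨e'⟩⟩ := h.2 Y hY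
    exact ⟨X, hX, ⟨e'.trans e⟩⟩

theorem ClassEquiv.iUnion {J : Type*} {C D : J → Set TopCat.{u}}
    (h : ∀ j, ClassEquiv (C j) (D j)) : ClassEquiv (⋃ j, C j) (⋃ j, D j) := by
  constructor
  · intro X hX
    obtain ⟨j, hj⟩ := mem_iUnion.1 hX
    obtain ⟨Y, hY, e⟩ := (h j).1 X hj
    exact ⟨Y, mem_iUnion.2 ⟨j, hY⟩, e⟩
  · intro X hX
    obtain ⟨j, hj⟩ := mem_iUnion.1 hX
    obtain ⟨Y, hY, e⟩ := (h j).2 X hj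
    exact ⟨Y, mem_iUnion.2 ⟨j, hY⟩, e⟩

/-- The members of a class of spaces that are nonempty. -/
def nonemptyPart (C : Set TopCat.{u}) : Set TopCat.{u} := {X ∈ C | Nonempty X}

theorem ClassEquiv.nonemptyPart {C D : Set TopCat.{u}} (h : ClassEquiv C D) :
    ClassEquiv (nonemptyPart C) (nonemptyPart D) := by
  constructor
  · rintro X ⟨hX, hne⟩
    obtain ⟨Y, hY, ⟨e⟩⟩ := h.1 X hX
    exact ⟨Y, ⟨hY, hne.map e⟩, ⟨e⟩⟩
  · rintro Y ⟨hY, hne⟩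
    obtain ⟨X, hX, ⟨e⟩⟩ := h.2 Y hY
    exact ⟨X, ⟨hX, hne.map e.symm⟩, ⟨e⟩⟩

theorem nonemptyPart_iUnion {J : Type*} (C : J → Set TopCat.{u}) :
    nonemptyPart (⋃ j, C j) = ⋃ j, nonemptyPart (C j) := by
  ext X; simp [nonemptyPart]

/-- An embedding carrying one fiber onto another one gives a homeomorphism of the fibers. -/
theorem nonempty_homeomorph_of_image_eq {A A' : Type*} [TopologicalSpace A] [TopologicalSpace A']
    {j : A → A'} (hj : IsEmbedding j) {s : Set A} {t : Set A'} (h : j '' s = t) :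
    Nonempty (s ≃ₜ t) :=
  ⟨(hj.homeomorphImage s).trans (Homeomorph.setCongr h)⟩

theorem isClosedMap_sigma_map_id {J : Type*} {X Y : J → Type*} [∀ j, TopologicalSpace (X j)]
    [∀ j, TopologicalSpace (Y j)] {q : ∀ j, X j → Y j} (h : ∀ j, IsClosedMap (q j)) :
    IsClosedMap (Sigma.map id q) := by
  intro s hs
  rw [isClosed_sigma_iff]
  intro j
  convert h j _ (isClosed_sigma_iff.1 hs j)
  ext b
  constructor
  · rintro ⟨⟨i, a⟩, has, hab⟩
    have h' : (⟨i, q i a⟩ : Σ j, Y j) = ⟨j, b⟩ := hab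
    cases h'
    exact ⟨a, has, rfl⟩
  · rintro ⟨a, ha, rfl⟩
    exact ⟨⟨j, a⟩, ha, rfl⟩

/-! ### Restrictions, sums and the handling of empty fibers. -/

namespace TopComposition

theorem isCompositionOf_iff {𝒜 : TopComposition.{u}} {C : Set TopCat.{u}} :
    𝒜.IsCompositionOf C ↔ (∀ b, ∃ X ∈ C, Nonempty ((𝒜.q ⁻¹' {b} : Set 𝒜.A) ≃ₜ X)) ∧
      ∀ X ∈ C, ∃ b, Nonempty ((𝒜.q ⁻¹' {b} : Set 𝒜.A) ≃ₜ X) := by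
  simp only [IsCompositionOf, ClassEquiv, fibers, Set.forall_mem_range, Set.exists_range_iff]

/-- The composition map is closed, open and surjective. -/
def IsOnto (𝒜 : TopComposition.{u}) : Prop :=
  IsClosedMap 𝒜.q ∧ IsOpenMap 𝒜.q ∧ Function.Surjective 𝒜.q

/-- The part of a composition lying over a subset of the indexing space. -/
def restrict (𝒜 : TopComposition.{u}) (S : Set 𝒜.B) : TopComposition.{u} where
  A := TopCat.of (𝒜.q ⁻¹' S)
  B := TopCat.of S
  q := ⟨S.restrictPreimage 𝒜.q, 𝒜.q.continuous.restrictPreimage⟩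

theorem restrict_fiber (𝒜 : TopComposition.{u}) (S : Set 𝒜.B) (b : S) :
    Nonempty (((𝒜.restrict S).q ⁻¹' {b} : Set (𝒜.restrict S).A) ≃ₜ
      (𝒜.q ⁻¹' {(b : 𝒜.B)} : Set 𝒜.A)) := by
  refine nonempty_homeomorph_of_image_eq
    (j := fun a : (𝒜.restrict S).A => ((show (𝒜.q ⁻¹' S : Set 𝒜.A) from a) : 𝒜.A))
    IsEmbedding.subtypeVal ?_
  ext a
  constructor
  · rintro ⟨a, rfl, rfl⟩
    rfl
  · intro ha
    have ha' : 𝒜.q a = b := ha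
    exact ⟨⟨a, by rw [mem_preimage, ha']; exact b.2⟩, Subtype.ext ha', rfl⟩

theorem restrict_isCompositionOf (𝒜 : TopComposition.{u}) (S : Set 𝒜.B) :
    (𝒜.restrict S).IsCompositionOf
      ((fun b : 𝒜.B => TopCat.of (𝒜.q ⁻¹' {b} : Set 𝒜.A)) '' S) := by
  rw [isCompositionOf_iff]
  constructor
  · intro b
    exact ⟨_, ⟨_, b.2, rfl⟩, 𝒜.restrict_fiber S b⟩
  · rintro _ ⟨b, hb, rfl⟩
    exact ⟨⟨b, hb⟩, 𝒜.restrict_fiber S ⟨b, hb⟩⟩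

theorem restrict_range_isCompositionOf (𝒜 : TopComposition.{u}) :
    (𝒜.restrict (range 𝒜.q)).IsCompositionOf (nonemptyPart 𝒜.fibers) := by
  convert 𝒜.restrict_isCompositionOf (range 𝒜.q)
  ext X
  constructor
  · rintro ⟨⟨b, rfl⟩, ⟨a, ha⟩⟩
    exact ⟨b, ⟨a, ha⟩, rfl⟩
  · rintro ⟨b, ⟨a, ha⟩, rfl⟩
    exact ⟨⟨b, rfl⟩, ⟨a, ha⟩⟩

theorem restrict_isOnto {𝒜 : TopComposition.{u}} (hc : IsClosedMap 𝒜.q) (ho : IsOpenMap 𝒜.q)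
    {S : Set 𝒜.B} (hS : S ⊆ range 𝒜.q) : (𝒜.restrict S).IsOnto := by
  refine ⟨hc.restrictPreimage S, ho.restrictPreimage S, ?_⟩
  rintro ⟨b, hb⟩
  obtain ⟨a, rfl⟩ := hS hb
  exact ⟨⟨a, hb⟩, rfl⟩

theorem IsCompactMetrizable.restrict {𝒜 : TopComposition.{u}} (h : 𝒜.IsCompactMetrizable)
    {S : Set 𝒜.B} (hS : IsClosed S) : (𝒜.restrict S).IsCompactMetrizable := by
  obtain ⟨⟨_, _⟩, _, _⟩ := h
  refine ⟨⟨?_, ?_⟩, ?_, ?_⟩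
  · exact isCompact_iff_compactSpace.1 (hS.preimage 𝒜.q.continuous).isCompact
  · exact inferInstanceAs (MetrizableSpace (𝒜.q ⁻¹' S))
  · exact isCompact_iff_compactSpace.1 hS.isCompact
  · exact inferInstanceAs (MetrizableSpace S)

theorem IsPolish.restrict {𝒜 : TopComposition.{u}} (h : 𝒜.IsPolish)
    {S : Set 𝒜.B} (hS : IsClosed S) : (𝒜.restrict S).IsPolish := by
  obtain ⟨_, _⟩ := h
  exact ⟨(hS.preimage 𝒜.q.continuous).polishSpace, hS.polishSpace⟩

/-- The disjoint sum of a family of compositions. -/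
def sigma {J : Type u} (ℬ : J → TopComposition.{u}) : TopComposition.{u} where
  A := TopCat.of (Σ j, (ℬ j).A)
  B := TopCat.of (Σ j, (ℬ j).B)
  q := ⟨Sigma.map id fun j => (ℬ j).q, Continuous.sigma_map fun j => (ℬ j).q.continuous⟩

theorem sigma_fiber {J : Type u} (ℬ : J → TopComposition.{u}) (j : J) (b : (ℬ j).B) :
    Nonempty (((sigma ℬ).q ⁻¹' {⟨j, b⟩} : Set (sigma ℬ).A) ≃ₜ
      ((ℬ j).q ⁻¹' {b} : Set (ℬ j).A)) := by
  have hj : IsEmbedding (Sigma.mk (β := fun j => (ℬ j).A) j) := IsEmbedding.sigmaMk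
  obtain ⟨e⟩ := nonempty_homeomorph_of_image_eq (A' := (sigma ℬ).A) hj
    (s := (ℬ j).q ⁻¹' {b}) (t := (sigma ℬ).q ⁻¹' {⟨j, b⟩}) (by
      ext ⟨i, a⟩
      constructor
      · rintro ⟨a, rfl, h⟩
        cases h
        rfl
      · intro h
        have h' : (⟨i, (ℬ i).q a⟩ : Σ j, (ℬ j).B) = ⟨j, b⟩ := h
        cases h'
        exact ⟨a, rfl, rfl⟩)
  exact ⟨e.symm⟩

theorem sigma_isCompositionOf {J : Type u} (ℬ : J → TopComposition.{u}) :
    (sigma ℬ).IsCompositionOf (⋃ j, (ℬ j).fibers) := by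
  rw [isCompositionOf_iff]
  constructor
  · rintro ⟨j, b⟩
    exact ⟨_, mem_iUnion.2 ⟨j, b, rfl⟩, sigma_fiber ℬ j b⟩
  · intro X hX
    obtain ⟨j, b, rfl⟩ := mem_iUnion.1 hX
    exact ⟨⟨j, b⟩, sigma_fiber ℬ j b⟩

theorem sigma_isOnto {J : Type u} {ℬ : J → TopComposition.{u}} (h : ∀ j, (ℬ j).IsOnto) :
    (sigma ℬ).IsOnto := by
  refine ⟨?_, ?_, ?_⟩
  · exact isClosedMap_sigma_map_id fun j => (h j).1
  · exact (isOpenMap_sigma_map (σ := fun j => (ℬ j).A) (τ := fun j => (ℬ j).B) (f₁ := id)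
      (f₂ := fun j => (ℬ j).q)).2 fun j => (h j).2.1
  · rintro ⟨j, b⟩
    obtain ⟨a, rfl⟩ := (h j).2.2 b
    exact ⟨⟨j, a⟩, rfl⟩

theorem sigma_isPolish {J : Type u} [Countable J] {ℬ : J → TopComposition.{u}}
    (h : ∀ j, (ℬ j).IsPolish) : (sigma ℬ).IsPolish := by
  have := fun j => (h j).1
  have := fun j => (h j).2
  exact ⟨inferInstanceAs (PolishSpace (Σ j, (ℬ j).A)),
    inferInstanceAs (PolishSpace (Σ j, (ℬ j).B))⟩

theorem sigma_isCompactMetrizable {J : Type u} [Finite J] {ℬ : J → TopComposition.{u}}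
    (h : ∀ j, (ℬ j).IsCompactMetrizable) : (sigma ℬ).IsCompactMetrizable := by
  have := fun j => (h j).1.1
  have := fun j => (h j).1.2
  have := fun j => (h j).2.1
  have := fun j => (h j).2.2
  exact ⟨⟨inferInstanceAs (CompactSpace (Σ j, (ℬ j).A)),
    inferInstanceAs (MetrizableSpace (Σ j, (ℬ j).A))⟩,
    inferInstanceAs (CompactSpace (Σ j, (ℬ j).B)),
    inferInstanceAs (MetrizableSpace (Σ j, (ℬ j).B))⟩

/-- Add an isolated point with an empty fiber to the indexing space if `P` holds. -/
def addEmpty (𝒜 : TopComposition.{u}) (P : Prop) : TopComposition.{u} where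
  A := 𝒜.A
  B := TopCat.of (𝒜.B ⊕ {_x : PUnit.{u + 1} // P})
  q := ⟨fun a => Sum.inl (𝒜.q a), continuous_inl.comp 𝒜.q.continuous⟩

theorem addEmpty_isStrong {𝒜 : TopComposition.{u}} (h : 𝒜.IsOnto) (P : Prop) :
    (𝒜.addEmpty P).IsStrong := by
  refine ⟨IsClosedEmbedding.inl.isClosedMap.comp h.1, isOpenMap_inl.comp h.2.1, ?_⟩
  rintro (b | b) hb (c | c) hc
  · obtain ⟨a, rfl⟩ := h.2.2 b
    exact absurd ⟨a, rfl⟩ hb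
  · obtain ⟨a, rfl⟩ := h.2.2 b
    exact absurd ⟨a, rfl⟩ hb
  · obtain ⟨a, rfl⟩ := h.2.2 c
    exact absurd ⟨a, rfl⟩ hc
  · exact congrArg Sum.inr (Subsingleton.elim b c)

theorem IsPolish.addEmpty {𝒜 : TopComposition.{u}} (h : 𝒜.IsPolish) (P : Prop) :
    (𝒜.addEmpty P).IsPolish := by
  obtain ⟨_, _⟩ := h
  refine ⟨‹_›, ?_⟩
  exact inferInstanceAs (PolishSpace (𝒜.B ⊕ {_x : PUnit.{u + 1} // P}))

theorem IsCompactMetrizable.addEmpty {𝒜 : TopComposition.{u}} (h : 𝒜.IsCompactMetrizable)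
    (P : Prop) : (𝒜.addEmpty P).IsCompactMetrizable := by
  obtain ⟨h, _, _⟩ := h
  refine ⟨h, ?_, ?_⟩
  · exact inferInstanceAs (CompactSpace (𝒜.B ⊕ {_x : PUnit.{u + 1} // P}))
  · exact inferInstanceAs (MetrizableSpace (𝒜.B ⊕ {_x : PUnit.{u + 1} // P}))

theorem addEmpty_isCompositionOf {𝒜 : TopComposition.{u}} {C : Set TopCat.{u}}
    (h : 𝒜.IsCompositionOf (nonemptyPart C)) :
    (𝒜.addEmpty (∃ X ∈ C, IsEmpty X)).IsCompositionOf C := by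
  have key : ∀ b : 𝒜.B, ((𝒜.addEmpty (∃ X ∈ C, IsEmpty X)).q ⁻¹' {Sum.inl b} : Set 𝒜.A) =
      𝒜.q ⁻¹' {b} := by
    intro b
    ext a
    exact Sum.inl_injective.eq_iff
  have key' : ∀ b, ((𝒜.addEmpty (∃ X ∈ C, IsEmpty X)).q ⁻¹' {Sum.inr b} : Set 𝒜.A) = ∅ := by
    intro b
    ext a
    exact iff_of_false Sum.inl_ne_inr id
  rw [isCompositionOf_iff] at h ⊢
  constructor
  · rintro (b | b)
    · obtain ⟨X, hX, ⟨e⟩⟩ := h.1 b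
      exact ⟨X, hX.1, ⟨(Homeomorph.setCongr (key b)).trans e⟩⟩
    · obtain ⟨X, hX, _⟩ := b.2
      have : IsEmpty (∅ : Set 𝒜.A) := inferInstance
      exact ⟨X, hX, ⟨(Homeomorph.setCongr (key' b)).trans Homeomorph.empty⟩⟩
  · intro X hX
    by_cases hne : Nonempty X
    · obtain ⟨b, ⟨e⟩⟩ := h.2 X ⟨hX, hne⟩
      exact ⟨Sum.inl b, ⟨(Homeomorph.setCongr (key b)).trans e⟩⟩
    · have hem : IsEmpty X := not_nonempty_iff.1 hne
      refine ⟨Sum.inr ⟨PUnit.unit, X, hX, hem⟩, ?_⟩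
      exact ⟨(Homeomorph.setCongr (key' _)).trans Homeomorph.empty⟩

theorem IsStrong.restrict_range_isOnto {𝒜 : TopComposition.{u}} (h : 𝒜.IsStrong) :
    (𝒜.restrict (range 𝒜.q)).IsOnto :=
  restrict_isOnto h.1 h.2.1 subset_rfl

end TopComposition

open TopComposition

/-- The range of a closed map is closed, so restricting to it stays within Polish spaces; conversely
an isolated point carries the empty fiber when the class has an empty member. This reduces strong
compositions to surjective ones, which are stable under sums. -/
theorem stronglyPolishable_iff {C : Set TopCat.{u}} : StronglyPolishable C ↔
    ∃ 𝒜 : TopComposition.{u}, 𝒜.IsOnto ∧ 𝒜.IsPolish ∧ 𝒜.IsCompositionOf (nonemptyPart C) := by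
  constructor
  · rintro ⟨𝒜, h, hP, hC⟩
    exact ⟨_, h.restrict_range_isOnto, hP.restrict h.1.isClosed_range,
      𝒜.restrict_range_isCompositionOf.trans hC.nonemptyPart⟩
  · rintro ⟨𝒜, h, hP, hC⟩
    exact ⟨_, addEmpty_isStrong h _, hP.addEmpty _, addEmpty_isCompositionOf hC⟩

theorem stronglyCompactifiable_iff {C : Set TopCat.{u}} : StronglyCompactifiable C ↔
    ∃ 𝒜 : TopComposition.{u}, 𝒜.IsOnto ∧ 𝒜.IsCompactMetrizable ∧
      𝒜.IsCompositionOf (nonemptyPart C) := by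
  constructor
  · rintro ⟨𝒜, h, hP, hC⟩
    exact ⟨_, h.restrict_range_isOnto, hP.restrict h.1.isClosed_range,
      𝒜.restrict_range_isCompositionOf.trans hC.nonemptyPart⟩
  · rintro ⟨𝒜, h, hP, hC⟩
    exact ⟨_, addEmpty_isStrong h _, hP.addEmpty _, addEmpty_isCompositionOf hC⟩

theorem Polishable.iUnion {J : Type u} [Countable J] {C : J → Set TopCat.{u}}
    (h : ∀ j, Polishable (C j)) : Polishable (⋃ j, C j) := by
  choose ℬ hℬ hC using h
  exact ⟨sigma ℬ, sigma_isPolish hℬ, (sigma_isCompositionOf ℬ).trans (ClassEquiv.iUnion hC)⟩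

theorem StronglyPolishable.iUnion {J : Type u} [Countable J] {C : J → Set TopCat.{u}}
    (h : ∀ j, StronglyPolishable (C j)) : StronglyPolishable (⋃ j, C j) := by
  simp only [stronglyPolishable_iff, nonemptyPart_iUnion] at h ⊢
  choose ℬ hℬ hP hC using h
  exact ⟨sigma ℬ, sigma_isOnto hℬ, sigma_isPolish hP,
    (sigma_isCompositionOf ℬ).trans (ClassEquiv.iUnion hC)⟩

/-! ### One-point compactification of a sum of compacta. -/

section OnePointSigma

variable {J : Type*} {X Y : J → Type*} [∀ j, TopologicalSpace (X j)] [∀ j, TopologicalSpace (Y j)]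

theorem IsCompact.finite_fst_image_sigma {s : Set (Σ j, X j)} (hs : IsCompact s) :
    (Sigma.fst '' s).Finite := by
  let _ : TopologicalSpace J := ⊥
  have : DiscreteTopology J := ⟨rfl⟩
  have hc : Continuous (Sigma.fst : (Σ j, X j) → J) :=
    continuous_sigma fun j => continuous_const
  exact (hs.image hc).finite_of_discrete

theorem isClosed_fst_preimage_sigma (t : Set J) :
    IsClosed (Sigma.fst ⁻¹' t : Set (Σ j, X j)) :=
  isClosed_sigma_iff.2 fun j => isClosed_const (p := j ∈ t)

theorem isCompact_fst_preimage_sigma [∀ j, CompactSpace (X j)] {t : Set J} (ht : t.Finite) :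
    IsCompact (Sigma.fst ⁻¹' t : Set (Σ j, X j)) := by
  have : (Sigma.fst ⁻¹' t : Set (Σ j, X j)) = ⋃ j ∈ t, range (Sigma.mk j) := by
    ext ⟨j, x⟩
    simp
  rw [this]
  exact ht.isCompact_biUnion fun j _ => isCompact_range continuous_sigmaMk

/-- A compact subset of a sum meets finitely many summands, and finitely many compact summands form
a closed compact set. -/
theorem OnePoint.mem_nhds_infty_sigma_iff [∀ j, CompactSpace (X j)]
    {s : Set (OnePoint (Σ j, X j))} :
    s ∈ 𝓝 (∞ : OnePoint (Σ j, X j)) ↔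
      ∞ ∈ s ∧ ∀ᶠ j in cofinite, ∀ x : X j, ((⟨j, x⟩ : Σ j, X j) : OnePoint (Σ j, X j)) ∈ s := by
  constructor
  · intro hs
    refine ⟨mem_of_mem_nhds hs, ?_⟩
    obtain ⟨K, ⟨-, hK⟩, hKs⟩ := OnePoint.hasBasis_nhds_infty.mem_iff.1 hs
    filter_upwards [hK.finite_fst_image_sigma.eventually_cofinite_notMem] with j hj x
    exact hKs (Or.inl ⟨_, fun hx => hj ⟨_, hx, rfl⟩, rfl⟩)
  · rintro ⟨h, hs⟩
    refine OnePoint.hasBasis_nhds_infty.mem_iff.2 ⟨Sigma.fst ⁻¹' _, ⟨?_,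
      isCompact_fst_preimage_sigma hs⟩, ?_⟩
    · exact isClosed_fst_preimage_sigma _
    · rintro _ (⟨⟨j, x⟩, hx, rfl⟩ | rfl)
      · exact not_not.1 hx x
      · exact h

theorem OnePoint.continuous_map_sigma [∀ j, CompactSpace (X j)] [∀ j, CompactSpace (Y j)]
    (p : ∀ j, C(X j, Y j)) :
    Continuous (OnePoint.map (Sigma.map id fun j => p j) :
      OnePoint (Σ j, X j) → OnePoint (Σ j, Y j)) := by
  rw [continuous_iff_continuousAt, OnePoint.forall]
  constructor
  · intro s hs
    obtain ⟨h, hs⟩ := OnePoint.mem_nhds_infty_sigma_iff.1 hs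
    exact OnePoint.mem_nhds_infty_sigma_iff.2 ⟨h, hs.mono fun j hj x => hj _⟩
  · intro x
    rw [OnePoint.continuousAt_coe]
    exact (OnePoint.continuous_coe.comp
      (Continuous.sigma_map fun j => (p j).continuous)).continuousAt

/-- Complements of finite subsums form a countable neighborhood base at infinity; a countable basis
of the sum handles the other points. -/
theorem OnePoint.secondCountableTopology_sigma [Countable J] [∀ j, CompactSpace (X j)]
    [∀ j, SecondCountableTopology (X j)] : SecondCountableTopology (OnePoint (Σ j, X j)) := by
  let b := countableBasis (Σ j, X j)
  have hb : IsTopologicalBasis b := isBasis_countableBasis _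
  let S : Set (Set (OnePoint (Σ j, X j))) :=
    (fun s => ((↑) '' s : Set (OnePoint (Σ j, X j)))) '' b ∪
      range fun t : Finset J => ((↑) '' (Sigma.fst ⁻¹' (t : Set J) : Set (Σ j, X j)))ᶜ
  have hS : IsTopologicalBasis S := by
    refine isTopologicalBasis_of_isOpen_of_nhds ?_ ?_
    · rintro _ (⟨s, hs, rfl⟩ | ⟨t, rfl⟩)
      · exact OnePoint.isOpen_image_coe.2 (hb.isOpen hs)
      · exact OnePoint.isOpen_compl_image_coe.2
          ⟨isClosed_fst_preimage_sigma _,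
            isCompact_fst_preimage_sigma t.finite_toSet⟩
    · intro x s hx hs
      induction x using OnePoint.rec with
      | infty =>
        obtain ⟨h, hf⟩ := OnePoint.mem_nhds_infty_sigma_iff.1 (hs.mem_nhds hx)
        refine ⟨_, Or.inr ⟨Set.Finite.toFinset hf, rfl⟩, OnePoint.infty_notMem_image_coe, ?_⟩
        intro y hy
        induction y using OnePoint.rec with
        | infty => exact h
        | coe y =>
          by_contra hys
          exact hy ⟨y, hf.mem_toFinset.2 fun hc => hys (hc y.2), rfl⟩
      | coe x =>
        obtain ⟨t, ht, hxt, hts⟩ := hb.exists_subset_of_mem_open (a := x)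
          (u := OnePoint.some ⁻¹' s) hx (hs.preimage OnePoint.continuous_coe)
        exact ⟨_, Or.inl ⟨t, ht, rfl⟩, ⟨x, hxt, rfl⟩, image_subset_iff.2 hts⟩
  exact hS.secondCountableTopology
    (((countable_countableBasis _).image _).union (countable_range _))

theorem OnePoint.metrizableSpace_sigma [Countable J] [∀ j, CompactSpace (X j)]
    [∀ j, MetrizableSpace (X j)] : MetrizableSpace (OnePoint (Σ j, X j)) := by
  have : ∀ j, SecondCountableTopology (X j) := fun j => by
    let _ := metrizableSpaceMetric (X j)
    infer_instance
  have : SecondCountableTopology (OnePoint (Σ j, X j)) := OnePoint.secondCountableTopology_sigma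
  have : WeaklyLocallyCompactSpace (Σ j, X j) := ⟨fun x => ⟨range (Sigma.mk x.1),
    isCompact_range continuous_sigmaMk, isOpen_range_sigmaMk.mem_nhds ⟨x.2, rfl⟩⟩⟩
  infer_instance

end OnePointSigma

/-! ### Attaching a sequence of compositions to a limit fiber. -/

/-- If the compact sets `S j` eventually enter every neighborhood of the compact set `K`, then
`K ∪ ⋃ j, S j` is compact. -/
theorem IsCompact.union_iUnion_of_eventually_subset {Z J : Type*} [TopologicalSpace Z] {K : Set Z}
    (hK : IsCompact K) {S : J → Set Z} (hS : ∀ j, IsCompact (S j))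
    (h : ∀ U, IsOpen U → K ⊆ U → ∀ᶠ j in cofinite, S j ⊆ U) : IsCompact (K ∪ ⋃ j, S j) := by
  classical
  refine isCompact_of_finite_subcover fun {ι} U hU hcov => ?_
  obtain ⟨t, ht⟩ := hK.elim_finite_subcover U hU (subset_union_left.trans hcov)
  have hfin : {j | ¬ S j ⊆ ⋃ i ∈ t, U i}.Finite := h _ (isOpen_biUnion fun i _ => hU i) ht
  obtain ⟨t', ht'⟩ := (hfin.isCompact_biUnion fun j _ => hS j).elim_finite_subcover U hU
    ((iUnion₂_subset fun j _ => (subset_iUnion S j).trans subset_union_right).trans hcov)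
  refine ⟨t ∪ t', union_subset ?_ (iUnion_subset fun j => ?_)⟩
  · exact ht.trans (biUnion_subset_biUnion_left fun i hi => Finset.mem_union_left _ hi)
  · by_cases hj : S j ⊆ ⋃ i ∈ t, U i
    · exact hj.trans (biUnion_subset_biUnion_left fun i hi => Finset.mem_union_left _ hi)
    · exact ((subset_biUnion_of_mem (u := S) (show j ∈ {j | ¬ S j ⊆ ⋃ i ∈ t, U i} from hj)).trans
        ht').trans (biUnion_subset_biUnion_left fun i hi => Finset.mem_union_right _ hi)

/-- The spaces `X j` are attached to `F` inside `OnePoint (Σ j, X j) × E`: the space `X j` is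
embedded as the graph of `f j`, and `F` sits over the point at infinity. -/
def attachedSet {J F E : Type*} {X : J → Type*} (f : ∀ j, X j → E) (φ : F → E) :
    Set (OnePoint (Σ j, X j) × E) :=
  range (fun y => (∞, φ y)) ∪ ⋃ j, range fun x : X j => (((⟨j, x⟩ : Σ j, X j) : OnePoint _), f j x)

theorem isCompact_attachedSet {J F E : Type*} {X : J → Type*} [∀ j, TopologicalSpace (X j)]
    [∀ j, CompactSpace (X j)] [TopologicalSpace F] [CompactSpace F] [MetricSpace E]
    {f : ∀ j, X j → E} (hf : ∀ j, Continuous (f j)) {φ : F → E} (hφ : Continuous φ)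
    (h : ∀ ε > 0, ∀ᶠ j in cofinite, ∀ x, ∃ y, dist (f j x) (φ y) < ε) :
    IsCompact (attachedSet f φ) := by
  refine (isCompact_range (continuous_const.prodMk hφ)).union_iUnion_of_eventually_subset
    (fun j => isCompact_range
      ((OnePoint.continuous_coe.comp continuous_sigmaMk).prodMk (hf j))) fun U hU hKU => ?_
  obtain ⟨V, W, hV, hW, hV', hW', hVW⟩ := generalized_tube_lemma
    (isCompact_singleton (x := (∞ : OnePoint (Σ j, X j)))) (isCompact_range hφ) hU (by
      rintro ⟨_, _⟩ ⟨rfl, y, rfl⟩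
      exact hKU ⟨y, rfl⟩)
  obtain ⟨δ, hδ, hδW⟩ := (isCompact_range hφ).exists_thickening_subset_open hW hW'
  filter_upwards [h δ hδ, (OnePoint.mem_nhds_infty_sigma_iff.1
    (hV.mem_nhds (hV' rfl))).2] with j hj hj'
  rintro _ ⟨x, rfl⟩
  obtain ⟨y, hy⟩ := hj x
  exact hVW ⟨hj' x, hδW (Metric.mem_thickening_iff.2 ⟨_, ⟨y, rfl⟩, hy⟩)⟩

/-- The hypothesis `h` gives compactness of the total space. The reverse estimate in the last clause
gives openness at the points over infinity: every fiber of a late composition has a point near each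
prescribed point of `F`. -/
theorem TopComposition.exists_attached {J : Type u} [Countable J] {ℬ : J → TopComposition.{u}}
    (hℬ : ∀ j, (ℬ j).IsCompactMetrizable) {F : Type u} [TopologicalSpace F] [CompactSpace F]
    {E : Type} [MetricSpace E] {f : ∀ j, (ℬ j).A → E} (hf : ∀ j, Continuous (f j)) {φ : F → E}
    (hφ : IsEmbedding φ)
    (h : ∀ ε > 0, ∀ᶠ j in cofinite, ∀ x, ∃ y, dist (f j x) (φ y) < ε) :
    ∃ 𝒜 : TopComposition.{u}, 𝒜.IsCompactMetrizable ∧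
      𝒜.IsCompositionOf (insert (TopCat.of F) (⋃ j, (ℬ j).fibers)) ∧
      ((∀ j, IsOpenMap (ℬ j).q) → (∀ ε > 0, ∀ y, ∀ᶠ j in cofinite, ∀ b, ∃ x, (ℬ j).q x = b ∧
        dist (f j x) (φ y) < ε) → IsOpenMap 𝒜.q) := by
  have := fun j => (hℬ j).1.1
  have := fun j => (hℬ j).1.2
  have := fun j => (hℬ j).2.1
  have := fun j => (hℬ j).2.2
  have : MetrizableSpace (OnePoint (Σ j, (ℬ j).A)) := OnePoint.metrizableSpace_sigma
  have : MetrizableSpace (OnePoint (Σ j, (ℬ j).B)) := OnePoint.metrizableSpace_sigma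
  let A := attachedSet f φ
  have hA : CompactSpace A := isCompact_iff_compactSpace.1
    (isCompact_attachedSet hf hφ.continuous h)
  let q : A → OnePoint (Σ j, (ℬ j).B) := fun a => OnePoint.map (Sigma.map id fun j => (ℬ j).q) a.1.1
  have hq : Continuous q := (OnePoint.continuous_map_sigma fun j => (ℬ j).q).comp
    (continuous_fst.comp continuous_subtype_val)
  let g : ∀ j, (ℬ j).A → A := fun j x =>
    ⟨(((⟨j, x⟩ : Σ j, (ℬ j).A) : OnePoint _), f j x), Or.inr (mem_iUnion.2 ⟨j, x, rfl⟩)⟩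
  have hgc : ∀ j, Continuous (g j) := fun j => Continuous.subtype_mk
    ((OnePoint.continuous_coe.comp
      (continuous_sigmaMk (σ := fun j => (ℬ j).A))).prodMk (hf j)) _
  have hg : ∀ j, IsEmbedding (g j) := fun j => IsEmbedding.of_comp (hgc j)
    (continuous_fst.comp continuous_subtype_val)
    (OnePoint.isOpenEmbedding_coe.isEmbedding.comp IsEmbedding.sigmaMk)
  let k : F → A := fun y => ⟨(∞, φ y), Or.inl ⟨y, rfl⟩⟩
  have hkc : Continuous k := Continuous.subtype_mk (continuous_const.prodMk hφ.continuous) _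
  have hk : IsEmbedding k := IsEmbedding.of_comp hkc
    (continuous_snd.comp continuous_subtype_val) hφ
  have hcases : ∀ a : A, (∃ y, a = k y) ∨ ∃ j x, a = g j x := by
    rintro ⟨_, ⟨y, rfl⟩ | ha⟩
    · exact Or.inl ⟨y, rfl⟩
    · obtain ⟨j, x, rfl⟩ := mem_iUnion.1 ha
      exact Or.inr ⟨j, x, rfl⟩
  have hfib : ∀ j b, g j '' ((ℬ j).q ⁻¹' {b}) =
      q ⁻¹' {((⟨j, b⟩ : Σ j, (ℬ j).B) : OnePoint (Σ j, (ℬ j).B))} := by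
    intro j b
    ext a
    constructor
    · rintro ⟨x, rfl, rfl⟩
      rfl
    · intro ha
      obtain ⟨y, rfl⟩ | ⟨i, x, rfl⟩ := hcases a
      · exact absurd ha (OnePoint.infty_ne_coe _)
      · have ha' : (⟨i, (ℬ i).q x⟩ : Σ j, (ℬ j).B) = ⟨j, b⟩ := OnePoint.coe_injective ha
        cases ha'
        exact ⟨x, rfl, rfl⟩
  have hfib' : k '' univ = q ⁻¹' {∞} := by
    ext a
    constructor
    · rintro ⟨y, -, rfl⟩
      rfl
    · intro ha
      obtain ⟨y, rfl⟩ | ⟨i, x, rfl⟩ := hcases a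
      · exact ⟨y, trivial, rfl⟩
      · exact absurd ha (OnePoint.coe_ne_infty _)
  obtain ⟨e⟩ := nonempty_homeomorph_of_image_eq hk hfib'
  refine ⟨⟨TopCat.of A, TopCat.of (OnePoint (Σ j, (ℬ j).B)), ⟨q, hq⟩⟩,
    ⟨⟨hA, inferInstanceAs (MetrizableSpace A)⟩,
      inferInstanceAs (CompactSpace (OnePoint (Σ j, (ℬ j).B))), this⟩, ?_, ?_⟩
  · rw [isCompositionOf_iff]
    constructor
    · intro b
      induction b using OnePoint.rec with
      | infty => exact ⟨_, Or.inl rfl, ⟨e.symm.trans (Homeomorph.Set.univ F)⟩⟩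
      | coe b =>
        obtain ⟨j, b⟩ := b
        obtain ⟨e'⟩ := nonempty_homeomorph_of_image_eq (hg j) (hfib j b)
        exact ⟨_, Or.inr (mem_iUnion.2 ⟨j, b, rfl⟩), ⟨e'.symm⟩⟩
    · rintro X (rfl | hX)
      · exact ⟨∞, ⟨e.symm.trans (Homeomorph.Set.univ F)⟩⟩
      · obtain ⟨j, b, rfl⟩ := mem_iUnion.1 hX
        obtain ⟨e'⟩ := nonempty_homeomorph_of_image_eq (hg j) (hfib j b)
        exact ⟨((⟨j, b⟩ : Σ j, (ℬ j).B) : OnePoint (Σ j, (ℬ j).B)), ⟨e'.symm⟩⟩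
  · intro ho hd
    change IsOpenMap q
    refine isOpenMap_iff_nhds_le.2 fun a => ?_
    obtain ⟨y, rfl⟩ | ⟨j, x, rfl⟩ := hcases a
    · intro s hs
      have hs' : q ⁻¹' s ∈ 𝓝 (k y) := hs
      obtain ⟨u, hu, hus⟩ := mem_nhds_subtype _ _ _ |>.1 hs'
      obtain ⟨V, hV, W, hW, hVW⟩ := mem_nhds_prod_iff.1 hu
      obtain ⟨ε, hε, hεW⟩ := Metric.mem_nhds_iff.1 hW
      refine OnePoint.mem_nhds_infty_sigma_iff.2 ⟨mem_of_mem_nhds (s := q ⁻¹' s) hs', ?_⟩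
      filter_upwards [hd ε hε y, (OnePoint.mem_nhds_infty_sigma_iff.1 hV).2] with j hj hj' b
      obtain ⟨x, rfl, hx⟩ := hj b
      exact hus (show g j x ∈ _ from hVW ⟨hj' x, hεW hx⟩)
    -- At `g j x` it suffices that `q ∘ g j` is open, since continuity of `g j` sends neighborhoods
    -- of `x` into any given neighborhood of `g j x`.
    · have hop : IsOpenMap fun x : (ℬ j).A =>
          (((⟨j, (ℬ j).q x⟩ : Σ j, (ℬ j).B)) : OnePoint (Σ j, (ℬ j).B)) :=
        OnePoint.isOpenMap_coe.comp (isOpenMap_sigmaMk.comp (ho j))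
      refine (hop.nhds_le x).trans ?_
      change map (q ∘ g j) (𝓝 x) ≤ _
      rw [← Filter.map_map]
      exact map_mono (hgc j).continuousAt

/-! ### Approximation by continuous images. -/

/-- Continuous images of `K` come arbitrarily close, in the Hausdorff distance, to the range
of `φ`. -/
def ApproximatedBy {F E : Type*} [MetricSpace E] (φ : F → E) (K : Type*) [TopologicalSpace K] :
    Prop :=
  ∀ ε > 0, ∃ g : C(K, E), (∀ x, ∃ y, dist (g x) (φ y) < ε) ∧ ∀ y, ∃ x, dist (g x) (φ y) < ε

theorem IsPreconnected.thickening {E : Type*} [NormedAddCommGroup E] [NormedSpace ℝ E] {s : Set E}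
    (hs : IsPreconnected s) (ε : ℝ) : IsPreconnected (Metric.thickening ε s) := by
  have h : Metric.thickening ε s = (fun z : E × E => z.1 + z.2) '' (s ×ˢ Metric.ball 0 ε) := by
    ext x
    rw [Metric.mem_thickening_iff]
    constructor
    · rintro ⟨y, hy, hxy⟩
      exact ⟨(y, x - y), ⟨hy, by simpa [dist_eq_norm] using hxy⟩, by simp⟩
    · rintro ⟨⟨y, z⟩, ⟨hy, hz⟩, rfl⟩
      exact ⟨y, hy, by simpa [dist_eq_norm] using hz⟩
  rw [h]
  exact (hs.prod (convex_ball 0 ε).isPreconnected).image _ continuous_add.continuousOn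

/-- The thickening of `F` is open and connected, hence contains a path through a finite `ε`-net of
`F`. By Tietze, `K` maps to the unit interval with distinct points of `S` sent to the parameters of
the net. Connectedness of `K` plays no role. -/
theorem exists_continuousMap_approx_of_infinite {E K : Type*} [NormedAddCommGroup E]
    [NormedSpace ℝ E] [TopologicalSpace K] [CompactSpace K] [T2Space K] {F : Set E}
    (hF : IsCompact F) (hF' : IsConnected F) {S : Set K} (hS : S.Infinite) {ε : ℝ} (hε : 0 < ε) :
    ∃ g : C(K, E), (∀ x, ∃ y ∈ F, dist (g x) y < ε) ∧ ∀ y ∈ F, ∃ x ∈ S, dist (g x) y < ε := by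
  have hpc : IsPathConnected (Metric.thickening ε F) :=
    Metric.isOpen_thickening.isConnected_iff_isPathConnected.1
      ⟨hF'.1.mono (Metric.self_subset_thickening hε F), hF'.2.thickening ε⟩
  obtain ⟨t, htF, htfin, ht⟩ := hF.finite_cover_balls hε
  obtain ⟨z, hz⟩ := hF'.1
  have htne : t.Nonempty := by
    obtain ⟨y, hy, -⟩ := mem_iUnion₂.1 (ht hz)
    exact ⟨y, hy⟩
  have : Finite t := htfin
  have : Nonempty t := htne.to_subtype
  obtain ⟨n, ⟨e⟩⟩ := Finite.exists_equiv_fin t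
  obtain _ | n := n
  · exact (e (Classical.arbitrary t)).elim0
  obtain ⟨γ, τ, hγ, hτ⟩ := hpc.exists_path_through_family' (fun i => (e.symm i : E))
    fun i => Metric.self_subset_thickening hε F (htF (e.symm i).2)
  let x : Fin (n + 1) → K := fun i => hS.natEmbedding S i
  have hx : Function.Injective x := fun i j hij =>
    Fin.val_injective ((hS.natEmbedding S).injective (Subtype.val_injective hij))
  obtain ⟨h, hh⟩ := ContinuousMap.exists_extension
    (continuous_of_discreteTopology.isClosedEmbedding hx) (⟨τ, continuous_of_discreteTopology⟩ :
      C(Fin (n + 1), unitInterval))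
  refine ⟨γ.toContinuousMap.comp h, fun x => Metric.mem_thickening_iff.1 (hγ (h x)), ?_⟩
  intro y hy
  obtain ⟨w, hw, hyw⟩ := mem_iUnion₂.1 (ht hy)
  refine ⟨x (e ⟨w, hw⟩), (hS.natEmbedding S _).2, ?_⟩
  have h1 : h (x (e ⟨w, hw⟩)) = τ (e ⟨w, hw⟩) := DFunLike.congr_fun hh (e ⟨w, hw⟩)
  have h2 : γ (h (x (e ⟨w, hw⟩))) = w := by rw [h1, hτ]; simp
  change dist (γ (h (x (e ⟨w, hw⟩)))) y < ε
  rw [h2, dist_comm]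
  exact hyw

theorem exists_continuousMap_approx {E K : Type*} [NormedAddCommGroup E]
    [NormedSpace ℝ E] [TopologicalSpace K] [CompactSpace K] [T2Space K] {F : Set E}
    (hF : IsCompact F) (hF' : IsConnected F) {S : Set K} (hne : S.Nonempty)
    (hS : F.Subsingleton ∨ S.Infinite) {ε : ℝ} (hε : 0 < ε) :
    ∃ g : C(K, E), (∀ x, ∃ y ∈ F, dist (g x) y < ε) ∧ ∀ y ∈ F, ∃ x ∈ S, dist (g x) y < ε := by
  obtain h | h := hS
  · obtain ⟨z, hz⟩ := hF'.1
    obtain ⟨x, hx⟩ := hne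
    refine ⟨ContinuousMap.const K z, fun _ => ⟨z, hz, by simpa using hε⟩, fun y hy => ⟨x, hx, ?_⟩⟩
    rw [h hy hz]
    simpa using hε
  · exact exists_continuousMap_approx_of_infinite hF hF' h hε

/-- Each connected piece of `F` is approximated from the matching clopen piece of `K`; the maps,
defined on all of `K`, are glued along the partition `d`. -/
theorem approximatedBy_of_partition {E F K I : Type*} [NormedAddCommGroup E] [NormedSpace ℝ E]
    [TopologicalSpace F] [CompactSpace F] [TopologicalSpace K] [CompactSpace K] [T2Space K]
    [TopologicalSpace I] [DiscreteTopology I] {φ : F → E} (hφ : Continuous φ) (c : C(F, I))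
    (hc : Function.Surjective c) (hc' : ∀ i, IsPreconnected (c ⁻¹' {i})) (d : C(K, I))
    (hd : Function.Surjective d) (h : ∀ i, (c ⁻¹' {i}).Subsingleton ∨ (d ⁻¹' {i}).Infinite) :
    ApproximatedBy φ K := by
  intro ε hε
  have key : ∀ i, ∃ g : C(K, E), (∀ x, ∃ y ∈ φ '' (c ⁻¹' {i}), dist (g x) y < ε) ∧
      ∀ y ∈ φ '' (c ⁻¹' {i}), ∃ x ∈ d ⁻¹' {i}, dist (g x) y < ε := by
    intro i
    refine exists_continuousMap_approx
      ((((isClosed_discrete {i}).preimage c.continuous).isCompact).image hφ)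
      ⟨Nonempty.image _ (hc i), (hc' i).image _ hφ.continuousOn⟩ (hd i)
      ((h i).imp_left fun hs => hs.image φ) hε
  choose g hg hg' using key
  have hcont : Continuous fun z : I × K => g z.1 z.2 :=
    continuous_prod_of_discrete_left.2 fun i => (g i).continuous
  refine ⟨⟨fun x => g (d x) x, hcont.comp (d.continuous.prodMk continuous_id)⟩, ?_, ?_⟩
  · intro x
    obtain ⟨_, ⟨y, -, rfl⟩, hy⟩ := hg (d x) x
    exact ⟨y, hy⟩
  · intro y
    obtain ⟨x, hx, hxy⟩ := hg' (c y) (φ y) ⟨y, rfl, rfl⟩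
    have hx' : d x = c y := hx
    exact ⟨x, by simpa [hx'] using hxy⟩

/-- A finite `ε`-net of `F` is the image of a locally constant map, one clopen piece of `K` for each
point of the net. -/
theorem approximatedBy_of_forall_fin {E F K : Type*} [MetricSpace E] [TopologicalSpace F]
    [CompactSpace F] [Nonempty F] [TopologicalSpace K] {φ : F → E} (hφ : Continuous φ)
    (h : ∀ n, ∃ d : C(K, Fin (n + 1)), Function.Surjective d) : ApproximatedBy φ K := by
  intro ε hε
  obtain ⟨t, htF, htfin, ht⟩ := (isCompact_range hφ).finite_cover_balls hε
  have htne : t.Nonempty := by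
    obtain ⟨y, hy, -⟩ := mem_iUnion₂.1 (ht (mem_range_self (Classical.arbitrary F)))
    exact ⟨y, hy⟩
  have : Finite t := htfin
  have : Nonempty t := htne.to_subtype
  obtain ⟨n, ⟨e⟩⟩ := Finite.exists_equiv_fin t
  obtain _ | n := n
  · exact (e (Classical.arbitrary t)).elim0
  obtain ⟨d, hd⟩ := h n
  refine ⟨(⟨fun i => (e.symm i : E), continuous_of_discreteTopology⟩ : C(Fin (n + 1), E)).comp d,
    fun x => ?_, fun y => ?_⟩
  · obtain ⟨y, hy⟩ := htF (e.symm (d x)).2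
    exact ⟨y, by simpa [hy] using hε⟩
  · obtain ⟨w, hw, hyw⟩ := mem_iUnion₂.1 (ht (mem_range_self y))
    obtain ⟨x, hx⟩ := hd (e ⟨w, hw⟩)
    refine ⟨x, ?_⟩
    simpa [hx, dist_comm] using hyw

/-! ### Component types and finitely many limit fibers. -/

/-- `K` is the disjoint sum of `a` one-point spaces and `b` infinite connected spaces. -/
def HasComponentType (K : Type*) [TopologicalSpace K] (a b : ℕ) : Prop :=
  ∃ c : C(K, Fin a ⊕ Fin b), Function.Surjective c ∧ (∀ i, IsPreconnected (c ⁻¹' {i})) ∧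
    (∀ i, (c ⁻¹' {Sum.inl i}).Subsingleton) ∧ ∀ i, (c ⁻¹' {Sum.inr i}).Infinite

theorem exists_surjective_fin_succ_of_not_isPreconnected {K : Type*} [TopologicalSpace K] {n : ℕ}
    {c : C(K, Fin n)} (hc : Function.Surjective c) {i : Fin n}
    (hi : ¬ IsPreconnected (c ⁻¹' {i})) :
    ∃ d : C(K, Fin (n + 1)), Function.Surjective d := by
  classical
  have hcl : IsClopen (c ⁻¹' {i}) := (isClopen_discrete {i}).preimage c.continuous
  rw [isPreconnected_iff_subset_of_fully_disjoint_closed hcl.1] at hi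
  push Not at hi
  obtain ⟨u, v, hu, hv, huv, hd, hsu, hsv⟩ := hi
  -- The disconnected piece is cut into two clopen parts: `w` receives the new last index and the
  -- rest keeps index `i`.
  let w := c ⁻¹' {i} ∩ v
  have hw : w = c ⁻¹' {i} ∩ uᶜ := by
    ext x
    constructor
    · rintro ⟨h1, h2⟩
      exact ⟨h1, fun h3 => hd.le_bot ⟨h3, h2⟩⟩
    · rintro ⟨h1, h2⟩
      exact ⟨h1, (huv h1).resolve_left h2⟩
  have hwcl : IsClopen w := ⟨hcl.1.inter hv, hw ▸ hcl.2.inter hu.isOpen_compl⟩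
  refine ⟨⟨fun x => if x ∈ w then Fin.last n else (c x).castSucc, ?_⟩, ?_⟩
  · refine Continuous.if (fun x hx => ?_) continuous_const
      (continuous_of_discreteTopology.comp c.continuous)
    have : x ∈ frontier w := hx
    simp [hwcl.frontier_eq] at this
  · intro j
    induction j using Fin.lastCases with
    | last =>
      obtain ⟨x, hx, hxu⟩ := not_subset.1 hsu
      have hxw : x ∈ w := by rw [hw]; exact ⟨hx, hxu⟩
      exact ⟨x, by simp [hxw]⟩
    | cast j =>
      by_cases hj : j = i
      · subst hj
        obtain ⟨x, hx, hxv⟩ := not_subset.1 hsv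
        have hxw : x ∉ w := fun h => hxv h.2
        have hx' : c x = j := hx
        exact ⟨x, by simp [hxw, hx']⟩
      · obtain ⟨x, rfl⟩ := hc j
        have hxw : x ∉ w := fun h => hj h.1
        exact ⟨x, by simp [hxw]⟩

/-- A clopen partition with the largest possible number of parts has connected parts, and a
connected T1 space with more than one point is infinite. -/
theorem exists_hasComponentType {K : Type*} [TopologicalSpace K] [T1Space K] [Nonempty K]
    (h : ¬ ∀ n, ∃ d : C(K, Fin (n + 1)), Function.Surjective d) :
    ∃ a b, HasComponentType K a b := by
  classical
  push Not at h
  have hn := Nat.find_spec h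
  have hmin := fun m => Nat.find_min h (m := m)
  generalize Nat.find h = n at hn hmin
  obtain _ | n := n
  · refine absurd ?_ (hn (ContinuousMap.const K 0))
    exact fun i => ⟨Classical.arbitrary K, Subsingleton.elim (α := Fin 1) _ _⟩
  obtain ⟨c, hc⟩ : ∃ d : C(K, Fin (n + 1)), Function.Surjective d := by
    simpa using hmin n n.lt_succ_self
  have hpre : ∀ i, IsPreconnected (c ⁻¹' {i}) := fun i => by
    by_contra hi
    obtain ⟨d, hd⟩ := exists_surjective_fin_succ_of_not_isPreconnected hc hi
    exact hn d hd
  let P : Fin (n + 1) → Prop := fun i => (c ⁻¹' {i}).Subsingleton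
  let e : Fin (n + 1) ≃ Fin (Fintype.card {i // P i}) ⊕ Fin (Fintype.card {i // ¬ P i}) :=
    (Equiv.sumCompl P).symm.trans (Equiv.sumCongr (Fintype.equivFin _) (Fintype.equivFin _))
  have hfib : ∀ i, (e ∘ c) ⁻¹' {i} = c ⁻¹' {e.symm i} := fun i => by
    ext x
    simp [Equiv.eq_symm_apply]
  refine ⟨_, _, ⟨e ∘ c, continuous_of_discreteTopology.comp c.continuous⟩, e.surjective.comp hc,
    fun i => ?_, fun i => ?_, fun i => ?_⟩
  · exact (hfib i).symm ▸ hpre _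
  · exact (hfib (Sum.inl i)).symm ▸ ((Fintype.equivFin {i // P i}).symm i).2
  · change ((e ∘ c) ⁻¹' {Sum.inr i}).Infinite
    rw [hfib]
    exact (hpre _).infinite_of_nontrivial
      (not_subsingleton_iff.1 ((Fintype.equivFin {i // ¬ P i}).symm i).2)

theorem HasComponentType.approximatedBy {E F K : Type*} [NormedAddCommGroup E] [NormedSpace ℝ E]
    [TopologicalSpace F] [CompactSpace F] [Nonempty F] [TopologicalSpace K] [CompactSpace K]
    [T2Space K] {φ : F → E} (hφ : Continuous φ) {a b a' b' : ℕ} (hF : HasComponentType F a b)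
    (hK : HasComponentType K a' b') (ha : a ≤ a') (hb : b ≤ b') : ApproximatedBy φ K := by
  obtain ⟨c, hc, hcp, hcl, -⟩ := hF
  obtain ⟨d, hd, -, -, hdr⟩ := hK
  have : Nonempty (Fin a ⊕ Fin b) := ⟨c (Classical.arbitrary F)⟩
  let e : Fin a ⊕ Fin b → Fin a' ⊕ Fin b' := Sum.map (Fin.castLE ha) (Fin.castLE hb)
  have he : Function.Injective e :=
    Sum.map_injective.2 ⟨Fin.castLE_injective ha, Fin.castLE_injective hb⟩
  refine approximatedBy_of_partition hφ c hc hcp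
    -- Pieces of `K` outside the range of `e` have no partner in `F` and may join any class;
    -- enlarging a class keeps it infinite.
    ⟨Function.invFun e ∘ d, continuous_of_discreteTopology.comp d.continuous⟩
    ((Function.invFun_surjective he).comp hd) ?_
  rintro (i | i)
  · exact Or.inl (hcl i)
  · refine Or.inr ((hdr (Fin.castLE hb i)).mono ?_)
    intro x hx
    have hx' : d x = e (Sum.inr i) := hx
    change Function.invFun e (d x) = Sum.inr i
    rw [hx', Function.leftInverse_invFun he]

/-- Minimal values form an antichain, hence a finite set, and every value lies above a minimal one.
-/
theorem exists_finite_minimal {P : Type*} {α : Type*} [PartialOrder α] [WellQuasiOrderedLE α]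
    (τ : P → α) : ∃ T : Set P, T.Finite ∧ ∀ p, ∃ t ∈ T, τ t ≤ τ p := by
  obtain hP | hP := isEmpty_or_nonempty P
  · exact ⟨∅, finite_empty, fun p => hP.elim p⟩
  have hfin : {x | Minimal (· ∈ range τ) x}.Finite :=
    WellQuasiOrderedLE.finite_of_isAntichain (setOfPred_minimal_antichain _)
  choose! r hr using fun (x : α) (hx : Minimal (· ∈ range τ) x) => hx.1
  refine ⟨_, hfin.image r, fun p => ?_⟩
  obtain ⟨x, hx, hx'⟩ := exists_minimal_le_of_wellFoundedLT (· ∈ range τ) (τ p) (mem_range_self p)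
  exact ⟨r x, ⟨x, hx', rfl⟩, by rw [hr x hx']; exact hx⟩

/-- Among a family of nonempty metrizable compacta, finitely many suffice to be approximated by
every member of the family. -/
theorem exists_finite_approximatedBy {E P : Type*} [NormedAddCommGroup E] [NormedSpace ℝ E]
    {K : P → Type*} [∀ p, TopologicalSpace (K p)] [∀ p, CompactSpace (K p)]
    [∀ p, T2Space (K p)] [∀ p, Nonempty (K p)] {φ : ∀ p, K p → E} (hφ : ∀ p, Continuous (φ p)) :
    ∃ T : Set P, T.Finite ∧ ∀ p, ∃ t ∈ T, ApproximatedBy (φ t) (K p) := by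
  let I : Set P := {p | ∀ n, ∃ d : C(K p, Fin (n + 1)), Function.Surjective d}
  by_cases hI : ∀ p, p ∈ I
  · obtain hP | ⟨⟨p₀⟩⟩ := isEmpty_or_nonempty P
    · exact ⟨∅, finite_empty, fun p => hP.elim p⟩
    · exact ⟨{p₀}, finite_singleton _,
        fun p => ⟨p₀, rfl, approximatedBy_of_forall_fin (hφ p₀) (hI p)⟩⟩
  push Not at hI
  obtain ⟨p₀, hp₀⟩ := hI
  choose a b hab using fun p : {p // p ∉ I} => exists_hasComponentType (K := K p) p.2
  obtain ⟨T, hT, h⟩ := exists_finite_minimal fun p => (a p, b p)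
  refine ⟨Subtype.val '' T, hT.image _, fun p => ?_⟩
  -- A member of `I` approximates every nonempty compactum, so any element of `T` works; `p₀ ∉ I`
  -- provides one.
  by_cases hp : p ∈ I
  · obtain ⟨t, ht, -⟩ := h ⟨p₀, hp₀⟩
    exact ⟨t, ⟨t, ht, rfl⟩, approximatedBy_of_forall_fin (hφ t) hp⟩
  · obtain ⟨t, ht, hle⟩ := h ⟨p, hp⟩
    exact ⟨t, ⟨t, ht, rfl⟩, (hab t).approximatedBy (hφ t) (hab ⟨p, hp⟩) hle.1 hle.2⟩

/-! ### Passing from one fiber to nearby fibers. -/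

/-- The constraints are convex and locally solved by constants: a value of `g` near points of `S`,
and anything off the closed set `S`. A partition of unity then gives `G`. -/
theorem exists_continuousMap_dist_lt_on {X E : Type*} [TopologicalSpace X] [CompactSpace X]
    [T2Space X] [NormedAddCommGroup E] [NormedSpace ℝ E] {S : Set X} (hS : IsClosed S)
    (g : C(S, E)) {ε : ℝ} (hε : 0 < ε) : ∃ G : C(X, E), ∀ x : S, dist (G x) (g x) < ε := by
  let t : X → Set E := fun x => {z | ∀ hx : x ∈ S, dist z (g ⟨x, hx⟩) < ε}
  have ht : ∀ x, Convex ℝ (t x) := fun x => by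
    have : t x = ⋂ hx : x ∈ S, Metric.ball (g ⟨x, hx⟩) ε := by
      ext z; simp [t]
    rw [this]
    exact convex_iInter fun hx => convex_ball _ _
  obtain ⟨G, hG⟩ := exists_continuous_forall_mem_convex_of_local_const ht fun x => by
    by_cases hx : x ∈ S
    · refine ⟨g ⟨x, hx⟩, ?_⟩
      have h : ∀ᶠ y in 𝓝 (⟨x, hx⟩ : S), dist (g ⟨x, hx⟩) (g y) < ε := by
        simpa only [dist_comm] using (g.continuous.tendsto _).eventually (Metric.ball_mem_nhds _ hε)
      rw [nhds_subtype_eq_comap, eventually_comap] at h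
      filter_upwards [h] with y hy hyS
      exact hy ⟨y, hyS⟩ rfl
    · refine ⟨0, ?_⟩
      filter_upwards [hS.isOpen_compl.mem_nhds hx] with y hy hyS
      exact absurd hyS hy
  exact ⟨G, fun x => hG x x.2⟩

/-- An approximation on one fiber extends to the nearby fibers. -/
theorem ApproximatedBy.exists_nhds {A B F E : Type*} [TopologicalSpace A] [CompactSpace A]
    [T2Space A] [TopologicalSpace B] [T2Space B] [CompactSpace B] [TopologicalSpace F]
    [CompactSpace F] [NormedAddCommGroup E] [NormedSpace ℝ E] {φ : F → E} (hφ : Continuous φ)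
    {q : A → B} (hq : Continuous q) (ho : IsOpenMap q) {b : B}
    (h : ApproximatedBy φ (q ⁻¹' {b})) {ε : ℝ} (hε : 0 < ε) :
    ∃ N ∈ 𝓝 b, IsClosed N ∧ ∃ g : C(A, E), (∀ a, q a ∈ N → ∃ y, dist (g a) (φ y) < ε) ∧
      ∀ b' ∈ N, ∀ y, ∃ a, q a = b' ∧ dist (g a) (φ y) < ε := by
  have hε3 : 0 < ε / 3 := by positivity
  obtain ⟨g₀, hg₀, hg₀'⟩ := h (ε / 3) hε3
  obtain ⟨g, hg⟩ := exists_continuousMap_dist_lt_on (isClosed_singleton.preimage hq) g₀ hε3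
  obtain ⟨t, htF, htfin, ht⟩ := (isCompact_range hφ).finite_cover_balls hε3
  -- Closedness of `q` keeps nearby fibers inside the thickening of `φ(F)`.
  have h1 : ∀ᶠ b' in 𝓝 b, ∀ a ∈ q ⁻¹' {b'}, ∃ y, dist (g a) (φ y) < ε := by
    have hU : IsOpen (g ⁻¹' Metric.thickening ε (range φ)) :=
      Metric.isOpen_thickening.preimage g.continuous
    have hsub : q ⁻¹' {b} ⊆ g ⁻¹' Metric.thickening ε (range φ) := fun a ha => by
      obtain ⟨y, hy⟩ := hg₀ ⟨a, ha⟩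
      refine Metric.mem_thickening_iff.2 ⟨φ y, ⟨y, rfl⟩, ?_⟩
      linarith [dist_triangle (g a) (g₀ ⟨a, ha⟩) (φ y), hg ⟨a, ha⟩]
    have hcl : IsClosed (q '' (g ⁻¹' Metric.thickening ε (range φ))ᶜ) :=
      hq.isClosedMap _ hU.isClosed_compl
    filter_upwards [hcl.isOpen_compl.mem_nhds (x := b) (by
      rintro ⟨a, ha, hab⟩
      exact ha (hsub hab))] with b' hb' a ha
    have : g a ∈ Metric.thickening ε (range φ) := by
      by_contra hc
      exact hb' ⟨a, hc, ha⟩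
    obtain ⟨_, ⟨y, rfl⟩, hy⟩ := Metric.mem_thickening_iff.1 this
    exact ⟨y, hy⟩
  -- Openness of `q` spreads a point near `z` to nearby fibers. A finite net makes the neighborhood
  -- uniform; the remaining `ε / 3` is the distance to the net.
  have h2 : ∀ᶠ b' in 𝓝 b, ∀ z ∈ t, ∃ a, q a = b' ∧ dist (g a) z < 2 * (ε / 3) := by
    rw [htfin.eventually_all]
    intro z hz
    obtain ⟨y, rfl⟩ := htF hz
    obtain ⟨x, hx⟩ := hg₀' y
    have hop : IsOpen (q '' {a | dist (g a) (φ y) < 2 * (ε / 3)}) :=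
      ho _ (isOpen_lt (g.continuous.dist continuous_const) continuous_const)
    filter_upwards [hop.mem_nhds (x := b) ⟨x, by
      change dist (g x) (φ y) < 2 * (ε / 3)
      linarith [dist_triangle (g x) (g₀ x) (φ y), hg x], x.2⟩] with b' hb'
    obtain ⟨a, ha, hab⟩ := hb'
    exact ⟨a, hab, ha⟩
  obtain ⟨N, hN, hNc, hNs⟩ := exists_mem_nhds_isClosed_subset (h1.and h2)
  refine ⟨N, hN, hNc, g, fun a ha => (hNs ha).1 a rfl, fun b' hb' y => ?_⟩
  obtain ⟨z, hz, hyz⟩ := mem_iUnion₂.1 (ht (mem_range_self y))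
  obtain ⟨a, ha, haz⟩ := (hNs hb').2 z hz
  refine ⟨a, ha, ?_⟩
  have hyz' : dist (φ y) z < ε / 3 := hyz
  linarith [dist_triangle_right (g a) (φ y) z]

/-! ### Countable unions in the compact cases. -/

theorem exists_isEmbedding_lp_infty (X : Type*) [TopologicalSpace X] [CompactSpace X]
    [MetrizableSpace X] : ∃ φ : X → lp (fun _ : ℕ => ℝ) ⊤, IsEmbedding φ := by
  let _ := metrizableSpaceMetric X
  exact ⟨_, (kuratowskiEmbedding.isometry X).isEmbedding⟩

theorem TopComposition.IsCompactMetrizable.compactSpace_fiber {𝒜 : TopComposition.{u}}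
    (h : 𝒜.IsCompactMetrizable) (b : 𝒜.B) : CompactSpace (𝒜.q ⁻¹' {b} : Set 𝒜.A) := by
  obtain ⟨⟨_, _⟩, _, _⟩ := h
  exact isCompact_iff_compactSpace.1 (isClosed_singleton.preimage 𝒜.q.continuous).isCompact

theorem TopComposition.IsCompositionOf.surjective {𝒜 : TopComposition.{u}} {C : Set TopCat.{u}}
    (h : 𝒜.IsCompositionOf C) (hC : ∀ X ∈ C, Nonempty X) : Function.Surjective 𝒜.q := by
  intro b
  obtain ⟨X, hX, ⟨e⟩⟩ := (isCompositionOf_iff.1 h).1 b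
  obtain ⟨x⟩ := hC X hX
  exact ⟨e.symm x, (e.symm x).2⟩

theorem Compactifiable.iUnion {J : Type u} [Countable J] {C : J → Set TopCat.{u}}
    (h : ∀ j, Compactifiable (C j)) : Compactifiable (⋃ j, C j) := by
  choose ℬ hℬ hC using h
  suffices ∃ 𝒜 : TopComposition.{u}, 𝒜.IsCompactMetrizable ∧
      𝒜.IsCompositionOf (⋃ j, (ℬ j).fibers) by
    obtain ⟨𝒜, h𝒜, h⟩ := this
    exact ⟨𝒜, h𝒜, h.trans (ClassEquiv.iUnion hC)⟩
  by_cases hne : ∃ j, Nonempty (ℬ j).A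
  · obtain ⟨i, ⟨a⟩⟩ := hne
    let F : Set (ℬ i).A := (ℬ i).q ⁻¹' {(ℬ i).q a}
    have : CompactSpace F := (hℬ i).compactSpace_fiber _
    have : MetrizableSpace (ℬ i).A := (hℬ i).1.2
    obtain ⟨φ, hφ⟩ := exists_isEmbedding_lp_infty F
    -- Without openness, all compositions may be sent to a single point of `F`.
    obtain ⟨𝒜, h𝒜, h, -⟩ := exists_attached hℬ (f := fun _ _ => φ ⟨a, rfl⟩)
      (fun j => continuous_const) hφ
      fun ε hε => Eventually.of_forall fun j x => ⟨⟨a, rfl⟩, by simpa using hε⟩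
    have hF : TopCat.of F ∈ ⋃ j, (ℬ j).fibers := mem_iUnion.2 ⟨i, (ℬ i).q a, rfl⟩
    rw [insert_eq_of_mem hF] at h
    exact ⟨𝒜, h𝒜, h⟩
  · have hem : ∀ j, IsEmpty (ℬ j).A := fun j => not_nonempty_iff.1 fun h => hne ⟨j, h⟩
    -- Here every fiber is empty, so a one-point indexing space suffices, or an empty one if there
    -- are no fibers at all.
    let B := {_x : PUnit.{u + 1} // Nonempty (Σ j, (ℬ j).B)}
    let 𝒜 : TopComposition.{u} := ⟨TopCat.of PEmpty, TopCat.of B, ⟨PEmpty.elim,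
      continuous_of_discreteTopology⟩⟩
    refine ⟨𝒜, ⟨⟨inferInstanceAs (CompactSpace PEmpty), inferInstanceAs (MetrizableSpace PEmpty)⟩,
      inferInstanceAs (CompactSpace B), inferInstanceAs (MetrizableSpace B)⟩, ?_⟩
    have : IsEmpty 𝒜.A := inferInstanceAs (IsEmpty PEmpty)
    rw [isCompositionOf_iff]
    constructor
    · rintro ⟨_, ⟨⟨j, b⟩⟩⟩
      have : IsEmpty (TopCat.of ((ℬ j).q ⁻¹' {b} : Set (ℬ j).A)) :=
        inferInstanceAs (IsEmpty ((ℬ j).q ⁻¹' {b} : Set (ℬ j).A))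
      exact ⟨_, mem_iUnion.2 ⟨j, b, rfl⟩, ⟨Homeomorph.empty⟩⟩
    · intro X hX
      obtain ⟨j, b, rfl⟩ := mem_iUnion.1 hX
      have : IsEmpty (TopCat.of ((ℬ j).q ⁻¹' {b} : Set (ℬ j).A)) :=
        inferInstanceAs (IsEmpty ((ℬ j).q ⁻¹' {b} : Set (ℬ j).A))
      exact ⟨⟨PUnit.unit, ⟨⟨j, b⟩⟩⟩, ⟨Homeomorph.empty⟩⟩

theorem TopComposition.exists_isOnto_iUnion {J : Type u} [Countable J] {ℬ : J → TopComposition.{u}}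
    (hO : ∀ j, (ℬ j).IsOnto) (hM : ∀ j, (ℬ j).IsCompactMetrizable) :
    ∃ 𝒜 : TopComposition.{u}, 𝒜.IsOnto ∧ 𝒜.IsCompactMetrizable ∧
      𝒜.IsCompositionOf (⋃ j, (ℬ j).fibers) := by
  have := fun j => (hM j).1.1
  have := fun j => (hM j).1.2
  have := fun j => (hM j).2.1
  have := fun j => (hM j).2.2
  let P := Σ j, (ℬ j).B
  let K : P → Type u := fun p => ((ℬ p.1).q ⁻¹' {p.2} : Set (ℬ p.1).A)
  let _ : ∀ p, TopologicalSpace (K p) := fun p =>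
    inferInstanceAs (TopologicalSpace ((ℬ p.1).q ⁻¹' {p.2} : Set (ℬ p.1).A))
  have _ : ∀ p, MetrizableSpace (K p) := fun p =>
    inferInstanceAs (MetrizableSpace ((ℬ p.1).q ⁻¹' {p.2} : Set (ℬ p.1).A))
  have _ : ∀ p, CompactSpace (K p) := fun p => (hM p.1).compactSpace_fiber p.2
  have _ : ∀ p, Nonempty (K p) := fun p =>
    let ⟨a, ha⟩ := (hO p.1).2.2 p.2
    ⟨⟨a, ha⟩⟩
  choose φ hφ using fun p => exists_isEmbedding_lp_infty (K p)
  obtain ⟨T, hT, hTP⟩ := exists_finite_approximatedBy fun p => (hφ p).continuous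
  have hTfin : Finite T := hT
  obtain ⟨e, he⟩ := exists_injective_nat J
  -- The injection into `ℕ` makes these tolerances tend to zero along the cofinite filter.
  let ε : J → ℝ := fun j => 1 / ((e j : ℝ) + 1)
  have hε0 : ∀ j, 0 < ε j := fun j => Nat.one_div_pos_of_nat
  have hε : Tendsto ε cofinite (𝓝 0) := by
    have h1 : Tendsto e cofinite atTop := Nat.cofinite_eq_atTop ▸ he.tendsto_cofinite
    exact tendsto_one_div_add_atTop_nhds_zero_nat.comp h1
  have hloc : ∀ (j : J) (b : (ℬ j).B), ∃ t : T, ∃ N ∈ 𝓝 b, IsClosed N ∧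
      ∃ g : C((ℬ j).A, lp (fun _ : ℕ => ℝ) ⊤),
        (∀ a, (ℬ j).q a ∈ N → ∃ y, dist (g a) (φ t y) < ε j) ∧
        ∀ b' ∈ N, ∀ y, ∃ a, (ℬ j).q a = b' ∧ dist (g a) (φ t y) < ε j := by
    intro j b
    obtain ⟨t, ht, hta⟩ := hTP ⟨j, b⟩
    exact ⟨⟨t, ht⟩, ApproximatedBy.exists_nhds (hφ t).continuous (ℬ j).q.continuous (hO j).2.1
      hta (hε0 j)⟩
  choose τ N hN hNc g hg hg' using hloc
  choose s hs using fun j => CompactSpace.elim_nhds_subcover (N j) (hN j)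
  let L : T → Type u := fun t => {z : Σ j, s j // τ z.1 z.2 = t}
  let 𝒟 : ∀ t, L t → TopComposition.{u} := fun t z => (ℬ z.1.1).restrict (N z.1.1 z.1.2)
  have hDM : ∀ t z, (𝒟 t z).IsCompactMetrizable := fun t z => (hM z.1.1).restrict (hNc _ _)
  have hDO : ∀ t z, (𝒟 t z).IsOnto := fun t z => restrict_isOnto (hO z.1.1).1 (hO z.1.1).2.1
    ((hO z.1.1).2.2.range_eq ▸ subset_univ _)
  -- Each `j` contributes only finitely many pieces, so the tolerances also tend to zero over the
  -- pieces.
  have hL : ∀ t, Tendsto (fun z : L t => ε z.1.1) cofinite (𝓝 0) := by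
    intro t
    refine hε.comp (Tendsto.cofinite_of_finite_preimage_singleton fun j => ?_)
    refine Finite.of_finite_image (f := Subtype.val) ?_ Subtype.val_injective.injOn
    refine (finite_range fun x : s j => (⟨j, x⟩ : Σ j, s j)).subset ?_
    rintro _ ⟨⟨⟨i, x⟩, hx⟩, rfl, rfl⟩
    exact ⟨x, rfl⟩
  have hatt : ∀ t : T, ∃ 𝒜 : TopComposition.{u}, 𝒜.IsOnto ∧ 𝒜.IsCompactMetrizable ∧
      𝒜.IsCompositionOf (insert (TopCat.of (K t)) (⋃ z, (𝒟 t z).fibers)) := by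
    intro t
    obtain ⟨𝒜, h𝒜, hc, ho⟩ := exists_attached (hDM t) (F := K t)
      (f := fun z a => g z.1.1 z.1.2 a.1)
      (fun z => (g z.1.1 z.1.2).continuous.comp continuous_subtype_val) (hφ t) (by
        intro δ hδ
        filter_upwards [(hL t).eventually_lt_const hδ] with z hz x
        obtain ⟨⟨j, b⟩, rfl⟩ := z
        obtain ⟨y, hy⟩ := hg j b x.1 x.2
        exact ⟨y, hy.trans hz⟩)
    have hopen : IsOpenMap 𝒜.q := by
      refine ho (fun z => (hDO t z).2.1) fun δ hδ y => ?_
      filter_upwards [(hL t).eventually_lt_const hδ] with z hz b'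
      obtain ⟨⟨j, b⟩, rfl⟩ := z
      obtain ⟨a, ha, hay⟩ := hg' j b b'.1 b'.2 y
      exact ⟨⟨a, by rw [mem_preimage, ha]; exact b'.2⟩, Subtype.ext ha, hay.trans hz⟩
    have := h𝒜.1.1
    have := h𝒜.2.2
    refine ⟨𝒜, ⟨𝒜.q.continuous.isClosedMap, hopen, hc.surjective ?_⟩, h𝒜, hc⟩
    rintro X (rfl | hX)
    · exact inferInstanceAs (Nonempty (K t))
    · obtain ⟨z, b, rfl⟩ := mem_iUnion.1 hX
      obtain ⟨a, ha⟩ := (hDO t z).2.2 b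
      exact ⟨⟨a, ha⟩⟩
  choose 𝒜 h𝒜O h𝒜M h𝒜C using hatt
  refine ⟨sigma 𝒜, sigma_isOnto h𝒜O, sigma_isCompactMetrizable h𝒜M,
    ((sigma_isCompositionOf 𝒜).trans (ClassEquiv.iUnion h𝒜C)).trans ⟨?_, ?_⟩⟩
  -- Overlaps among the pieces only repeat fibers, and each attached limit is itself an original
  -- fiber.
  · intro X hX
    obtain ⟨t, rfl | hX⟩ := mem_iUnion.1 hX
    · exact ⟨_, mem_iUnion.2 ⟨t.1.1, t.1.2, rfl⟩, ⟨Homeomorph.refl _⟩⟩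
    · obtain ⟨z, b, rfl⟩ := mem_iUnion.1 hX
      exact ⟨_, mem_iUnion.2 ⟨z.1.1, b.1, rfl⟩, restrict_fiber _ _ b⟩
  · intro X hX
    obtain ⟨j, b, rfl⟩ := mem_iUnion.1 hX
    obtain ⟨c, hc, hbc⟩ := mem_iUnion₂.1 ((hs j).ge (mem_univ b))
    exact ⟨_, mem_iUnion.2 ⟨τ j c, Or.inr (mem_iUnion.2 ⟨⟨⟨j, ⟨c, hc⟩⟩, rfl⟩, ⟨b, hbc⟩, rfl⟩)⟩,
      restrict_fiber _ _ ⟨b, hbc⟩⟩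

theorem StronglyCompactifiable.iUnion {J : Type u} [Countable J] {C : J → Set TopCat.{u}}
    (h : ∀ j, StronglyCompactifiable (C j)) : StronglyCompactifiable (⋃ j, C j) := by
  simp only [stronglyCompactifiable_iff, nonemptyPart_iUnion] at h ⊢
  choose ℬ hO hM hC using h
  obtain ⟨𝒜, h𝒜O, h𝒜M, h𝒜C⟩ := exists_isOnto_iUnion hO hM
  exact ⟨𝒜, h𝒜O, h𝒜M, h𝒜C.trans (ClassEquiv.iUnion hC)⟩

theorem mainTheorem6 {ι : Type v} [Countable ι] (C : ι → Set TopCat.{u}) :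
    ((∀ i, StronglyCompactifiable (C i)) → StronglyCompactifiable (⋃ i, C i)) ∧
    ((∀ i, Compactifiable (C i)) → Compactifiable (⋃ i, C i)) ∧
    ((∀ i, StronglyPolishable (C i)) → StronglyPolishable (⋃ i, C i)) ∧
    ((∀ i, Polishable (C i)) → Polishable (⋃ i, C i)) := by
  -- Sums must stay in universe `u`, so the countable index set is replaced by a copy there.
  have : Small.{u} ι := Countable.toSmall ι
  have e : Shrink.{u} ι ≃ ι := (equivShrink.{u} ι).symm
  have : Countable (Shrink.{u} ι) := e.countable_iff.2 inferInstance
  rw [← e.surjective.iUnion_comp]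
  exact ⟨fun h => StronglyCompactifiable.iUnion fun j => h (e j),
    fun h => Compactifiable.iUnion fun j => h (e j),
    fun h => StronglyPolishable.iUnion fun j => h (e j),
    fun h => Polishable.iUnion fun j => h (e j)⟩
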